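/- Let $f\in\mathbb Z[x]$ be a monic irreducible polynomial of degree $n>1$, let $N>1$ be an integer all of whose prime divisors are greater than $n$, let $K=\mathbb Q(\theta)$ with $f(\theta)=0$, and let $\mathbb Z_K$ be its ring of integers. For a nonzero prime $\mathfrak p$ of $\mathbb Z_K$ let $v_{\mathfrak p}$ be the normalized discrete valuation of $K$ at $\mathfrak p$. Let $$f\equiv g_1^{\ell_1}\cdots g_m^{\ell_m}\pmod N$$ be the squarefree decomposition of $f$ modulo $N$: the $g_i\in\mathbb Z[x]$ are monic and nonconstant, squarefree modulo every prime $p\mid N$, pairwise coprime in $(\mathbb Z/N)[x]$, and $0\le\ell_1<\cdots<\ell_m$. Fix $g=g_i$ with $g\neq f$, and put $\ell=\ell_i$. Let $f=a_0+a_1g+\cdots+a_rg^r$, $\deg a_s<\deg g$, be the $g$-expansion of $f$. For a nonzero integer $a$, the routine $v_N$ divides $a$ by $N$ as long as the remainder is $0$. If the first nonzero remainder is coprime to $N$, then $v_N(a)$ is the number of exact divisions performed; otherwise the routine fails. Set $v_N(0)=\infty$, and for a polynomial let $v_N$ be the minimum of the values at its coefficients. Put $u_s=v_N(a_s)$, let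 $N_g(f)$ be the lower convex hull of the points $(s,u_s)$ with $u_s<\infty$, and let $N_g^-(f)$ be the part of it formed by the sides of negative slope. The routine $\gcd_0(h_1,h_2)$ in $(\mathbb Z/N)[x]$ is the Euclidean algorithm which, before each division, makes the divisor monic, and which fails if the leading coefficient of the divisor is not a unit. Assume that the construction of $N_g^-(f)$ does not fail, that is, the routine $v_N$ does not fail on any coefficient of $a_0,\dots,a_\ell$. Assume also that for every vertex $(s,u_s)$ of $N_g^-(f)$ the routine $\gcd_0$ does not fail and outputs $\gcd_0\bigl(\overline{a_s/N^{u_s}},\overline g\bigr)=1$, where bars denote reduction modulo $N$. Let $p$ be a prime divisor of $N$, let $\rho=v_p(N)$, let $\mathcal P(p)$ be the set of primes of $\mathbb Z_K$ dividing $p$, and let $\mathcal P_g$ be the set of primes $\mathfrak p$ of $\mathbb Z_K$ dividing $N$ with $v_{\mathfrak p}(g(\theta))>0$. Put $$\mathcal P_{p,g}:=\mathcal P_g\cap\mathcal P(p).$$ Then $\mathcal P_{p,g}=\{\mathfrak p\in\mathcal P(p)\mid v_{\mathfrak p}(g(\theta))>0\}$, and there is a disjoint decomposition $$\mathcal P_{p,g}=\coprod_{\lambda}\mathcal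 P_{p,g,\lambda},\qquad \mathcal P_{p,g,\lambda}=\{\mathfrak p\in\mathcal P_{p,g}\mid v_{\mathfrak p}(g(\theta))=e(\mathfrak p/p)\,\rho\,\lambda\},$$ for $-\lambda$ running on the slopes of $N_g^-(f)$, where $e(\mathfrak p/p)$ is the ramification index of $\mathfrak p$ over $p$. -/

import Mathlib

namespace OreModN

open Polynomial IsDedekindDomain NumberField

/-! ### The `N`-adic valuation routine -/

/-- The loop of the `N`-adic valuation routine: divide `q` by `N` as long as the remainder is `0`,
counting the divisions in `value`; then compute `d = gcd(r, N)` for the last remainder `r`.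
The result is `inl d` if `d ≠ 1` (the routine fails, having found a divisor of `N`), and
`inr value` otherwise. (The guards `1 < N`, `q ≠ 0` only serve termination.) -/
def vNLoop (N : ℕ) (q : ℤ) (value : ℕ) : ℕ ⊕ ℕ :=
  if 1 < N ∧ q ≠ 0 ∧ q % (N : ℤ) = 0 then vNLoop N (q / (N : ℤ)) (value + 1)
  else if Int.gcd (q % (N : ℤ)) (N : ℤ) = 1 then Sum.inr value
  else Sum.inl (Int.gcd (q % (N : ℤ)) (N : ℤ))
termination_by q.natAbs
decreasing_by
  rename_i h
  obtain ⟨h1, h2, h3⟩ := h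
  have h4 : (N : ℤ) * (q / (N : ℤ)) = q := Int.mul_ediv_cancel' (Int.dvd_of_emod_eq_zero h3)
  have h5 : q / (N : ℤ) ≠ 0 := by
    intro h0
    rw [h0, mul_zero] at h4
    exact h2 h4.symm
  have h6 : q.natAbs = N * (q / (N : ℤ)).natAbs := by
    conv_lhs => rw [← h4, Int.natAbs_mul, Int.natAbs_natCast]
  have h7 : 0 < (q / (N : ℤ)).natAbs := Int.natAbs_pos.mpr h5
  rw [h6]
  nlinarith

/-- The `N`-adic valuation routine `v_N`, with the convention `v_N(0) = ∞`. -/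
def vN (N : ℕ) (a : ℤ) : ℕ ⊕ ℕ∞ :=
  if a = 0 then Sum.inr ⊤ else (vNLoop N a 0).map id (fun k => (k : ℕ∞))

/-- The output of the routine `v_N` (with the junk value `0` where the routine fails). -/
def vNValue (N : ℕ) (a : ℤ) : ℕ∞ := Sum.elim (fun _ => 0) id (vN N a)

/-- `v_N` does not fail on any of the coefficients of `P`. -/
def VNSucceeds (N : ℕ) (P : ℤ[X]) : Prop := ∀ s, ∃ k : ℕ∞, vN N (P.coeff s) = Sum.inr k

/-- `v_N` of a polynomial: the minimum of `v_N` of its coefficients (`∞` for `P = 0`). -/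
noncomputable def vNPoly (N : ℕ) (P : ℤ[X]) : ℕ∞ := P.support.inf fun s => vNValue N (P.coeff s)

/-! ### The routine `GCD₀` -/

/-- The routine `GCD₀` in `(ℤ/N)[x]`. While `g ≠ 0`: let `a` be the leading coefficient of `g` and
`b = gcd(a, N)`; if `b ≠ 1`, stop with the divisor `b` of `N` (output `inl b`, the routine fails);
otherwise replace `g` by `a⁻¹ g`, and `(f, g)` by `(g, r)`, where `r` is the remainder of the
division of `f` by the new `g`. When `g = 0`, the output is `inr f`. -/
noncomputable def gcd₀ (N : ℕ) (f g : (ZMod N)[X]) : ℕ ⊕ (ZMod N)[X] :=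
  open scoped Classical in
  if g = 0 then Sum.inr f
  else if Nat.gcd g.leadingCoeff.val N = 1 then
    gcd₀ N (C g.leadingCoeff⁻¹ * g) (f %ₘ (C g.leadingCoeff⁻¹ * g))
  else Sum.inl (Nat.gcd g.leadingCoeff.val N)
termination_by g.degree
decreasing_by
  rename_i hg hb
  have hnt : Nontrivial (ZMod N) := by
    by_contra hs
    rw [not_nontrivial_iff_subsingleton] at hs
    exact hg (Subsingleton.elim _ _)
  have h1 : g.leadingCoeff⁻¹ * g.leadingCoeff = 1 := by
    rw [mul_comm, ZMod.mul_inv_eq_gcd, hb, Nat.cast_one]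
  have hm : (C g.leadingCoeff⁻¹ * g).Monic := monic_C_mul_of_mul_leadingCoeff_eq_one h1
  refine lt_of_lt_of_eq (degree_modByMonic_lt f hm) ?_
  exact degree_C_mul_of_mul_ne_zero (by rw [h1]; exact one_ne_zero)

/-! ### Squarefree decomposition modulo `N` -/

/-- `f ≡ g₁^{ℓ₁} ⋯ g_m^{ℓ_m} (mod N)` is the squarefree decomposition of `f` modulo `N`:
the `g_i` are monic and nonconstant, squarefree modulo every prime `p ∣ N`, pairwise coprime in
`(ℤ/N)[x]`, and `ℓ₁ < ⋯ < ℓ_m`. -/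
structure IsSquarefreeDecomposition (N : ℕ) (f : ℤ[X]) {m : ℕ} (g : Fin m → ℤ[X])
    (l : Fin m → ℕ) : Prop where
  monic : ∀ i, (g i).Monic
  natDegree_pos : ∀ i, 0 < (g i).natDegree
  squarefree : ∀ i, ∀ p : ℕ, p.Prime → p ∣ N → Squarefree ((g i).map (Int.castRingHom (ZMod p)))
  coprime : ∀ i j, i ≠ j →
    IsCoprime ((g i).map (Int.castRingHom (ZMod N))) ((g j).map (Int.castRingHom (ZMod N)))
  strictMono : StrictMono l
  prod_eq : f.map (Int.castRingHom (ZMod N)) =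
    ∏ i, (g i).map (Int.castRingHom (ZMod N)) ^ l i

/-! ### The `g`-expansion and the Newton polygon -/

/-- The coefficient `a_i` of the `g`-expansion `f = a₀ + a₁ g + ⋯ + a_r g^r`, `deg a_i < deg g`,
for `g` monic: `a_i` is the remainder at the `i`-th step of the successive divisions by `g`. -/
noncomputable def expCoeff (g f : ℤ[X]) (i : ℕ) : ℤ[X] := ((fun q => q /ₘ g)^[i] f) %ₘ g

/-- The ordinates `u_i = v_N(a_i)` of the cloud of points of the `g`-Newton polygon of `f`. -/
noncomputable def ordinate (N : ℕ) (g f : ℤ[X]) (i : ℕ) : ℕ∞ := vNPoly N (expCoeff g f i)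

/-- The points `(s, u s)` and `(t, u t)`, `s < t`, are the endpoints of a side of slope `-lam` of
the lower convex hull of the set of all points `(i, u i)` with `u i < ∞`: they lie on a line of
slope `-lam`, no point of the set lies below this line, and all the points of the set that lie on
this line have their abscissas between `s` and `t`. -/
structure IsSide (u : ℕ → ℕ∞) (s t : ℕ) (lam : ℚ) : Prop where
  lt : s < t
  left_ne_top : u s ≠ ⊤
  right_ne_top : u t ≠ ⊤
  slope : ((u s).toNat : ℚ) - ((u t).toNat : ℚ) = lam * ((t : ℚ) - (s : ℚ))
  below : ∀ i, u i ≠ ⊤ → ((u s).toNat : ℚ) - lam * ((i : ℚ) - (s : ℚ)) ≤ ((u i).toNat : ℚ)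
  maximal : ∀ i, u i ≠ ⊤ →
    ((u i).toNat : ℚ) = ((u s).toNat : ℚ) - lam * ((i : ℚ) - (s : ℚ)) → s ≤ i ∧ i ≤ t

/-- The set of all `lam > 0` such that `-lam` is a slope of the principal polygon `N_g^-(f)`, the
part of the `g`-Newton polygon of `f` formed by the sides of negative slope. -/
def principalSlopes (N : ℕ) (g f : ℤ[X]) : Set ℚ :=
  {lam | 0 < lam ∧ ∃ s t, IsSide (ordinate N g f) s t lam}

/-- `s` is the abscissa of a vertex of the principal polygon `N_g^-(f)`, that is, of an endpoint of
one of its sides. -/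
def IsPrincipalVertex (N : ℕ) (g f : ℤ[X]) (s : ℕ) : Prop :=
  ∃ lam : ℚ, 0 < lam ∧ ∃ t,
    IsSide (ordinate N g f) s t lam ∨ IsSide (ordinate N g f) t s lam

/-- The polynomial `P / M`, for an integer `M` dividing all the coefficients of `P`. -/
noncomputable def intDiv (P : ℤ[X]) (M : ℤ) : ℤ[X] :=
  ∑ s ∈ P.support, monomial s (P.coeff s / M)

/-- The class of `a_s / N^{u_s}` in `(ℤ/N)[x]`. -/
noncomputable def vertexCoeff (N : ℕ) (g f : ℤ[X]) (s : ℕ) : (ZMod N)[X] :=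
  (intDiv (expCoeff g f s) ((N : ℤ) ^ (ordinate N g f s).toNat)).map (Int.castRingHom (ZMod N))

/-! ### Primes of the number field -/

variable {K : Type*} [Field K] [NumberField K]

/-- The normalized discrete valuation `v_𝔭` of `K` attached to a prime `𝔭` of its ring of integers,
with `v_𝔭(0) = ∞`. -/
noncomputable def ord (𝔭 : HeightOneSpectrum (𝓞 K)) (α : K) : WithTop ℚ :=
  open scoped Classical in
  if α = 0 then ⊤ else (((-WithZero.log (𝔭.valuation K α) : ℤ) : ℚ) : WithTop ℚ)

variable (K) in
/-- The set of prime ideals of the ring of integers of `K` dividing the positive integer `M`. -/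
def primesDividing (M : ℕ) : Set (HeightOneSpectrum (𝓞 K)) :=
  {𝔭 | 𝔭.asIdeal ∣ Ideal.span {(M : 𝓞 K)}}

/-- The set `𝒫_g` of the primes `𝔭` dividing `N` with `v_𝔭(g(θ)) > 0`. -/
def primesG (N : ℕ) (g : ℤ[X]) (θ : K) : Set (HeightOneSpectrum (𝓞 K)) :=
  {𝔭 ∈ primesDividing K N | 0 < ord 𝔭 (aeval θ g)}

/-- The set `𝒫_{p,g} = 𝒫_g ∩ 𝒫(p)`. -/
def primesPG (N p : ℕ) (g : ℤ[X]) (θ : K) : Set (HeightOneSpectrum (𝓞 K)) :=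
  primesG N g θ ∩ primesDividing K p

/-- The set `𝒫_{p,g,λ}` of the `𝔭` in `𝒫_{p,g}` with `v_𝔭(g(θ)) = e(𝔭/p) ρ λ`, `ρ = v_p(N)`. -/
def primesPGSlope (N p : ℕ) (g : ℤ[X]) (θ : K) (lam : ℚ) : Set (HeightOneSpectrum (𝓞 K)) :=
  {𝔭 ∈ primesPG N p g θ | ord 𝔭 (aeval θ g) =
    (((𝔭.asIdeal.ramificationIdx ℤ : ℚ) * (padicValNat p N : ℚ) * lam : ℚ) : WithTop ℚ)}

end OreModN

open OreModN Polynomial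

/-!
# Slopes of the principal polygon and the valuations of `g(θ)`

Let `𝔭` be a prime above `p ∣ N`, write `E = e(𝔭/p) v_p(N)`, so that `v_𝔭(N) = E`, and suppose that
`γ = v_𝔭(g(θ))` is positive. Since `N ^ u_i` divides `a_i`, the terms of
`0 = f(θ) = ∑ a_i(θ) g(θ)^i` satisfy `v_𝔭(a_i(θ) g(θ)^i) ≥ E u_i + γ i = E (u_i + μ i)` with
`μ = γ / E`. The minimum of `u_i + μ i` is the ordinate at the origin of the line of slope `-μ`
supporting the cloud of points `(i, u_i)`.

* If the line meets the cloud in two points, it carries a side of slope `-μ`, which is the claim.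
* If it meets the cloud in a single point `(s, u_s)`, that point is a vertex of the principal
  polygon (`exists_isSide_or_vertex`). The hypothesis on the vertices says that `a_s / N ^ u_s` is
  coprime to `g` modulo `N`; as `𝔭` contains both `N` and `g(θ)`, it does not contain
  `(a_s / N ^ u_s)(θ)`, hence `v_𝔭(a_s(θ)) = E u_s` exactly. The term of index `s` then has strictly
  smaller valuation than all the others, and the sum cannot vanish.

That the principal polygon runs exactly from abscissa `0` to abscissa `ℓ` comes from the
factorization `f ≡ g ^ ℓ h (mod N)` with `h` coprime to `g`: it gives `N ∣ a_i` for `i < ℓ` and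
`N ∤ a_ℓ`, while `a_0 ≠ 0` because `f` is irreducible and different from `g`.
The factorization also shows that `𝒫_{p,g}` is empty when `ℓ = 0`, and that `g(θ) ≠ 0` otherwise.
-/

namespace OreModN

open Polynomial IsDedekindDomain NumberField

/-! ### The valuation routine -/

theorem pow_dvd_of_vNLoop_eq_inr {N : ℕ} {q : ℤ} {k m : ℕ} (h : vNLoop N q k = Sum.inr m) :
    ∃ d, m = k + d ∧ (N : ℤ) ^ d ∣ q := by
  fun_induction vNLoop N q k with
  | case1 q k hq ih =>
    obtain ⟨d, hd, hdvd⟩ := ih h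
    refine ⟨d + 1, by omega, ?_⟩
    rw [← Int.mul_ediv_cancel' (Int.dvd_of_emod_eq_zero hq.2.2), pow_succ']
    exact mul_dvd_mul_left _ hdvd
  | case2 q k hq hg => exact ⟨0, by simpa using h.symm, by simp⟩
  | case3 q k hq hg => simp at h

theorem lt_of_vNLoop_eq_inr {N : ℕ} (hN : 1 < N) {q : ℤ} (hq : q ≠ 0) (hdvd : (N : ℤ) ∣ q)
    {k m : ℕ} (h : vNLoop N q k = Sum.inr m) : k < m := by
  rw [vNLoop, if_pos ⟨hN, hq, Int.emod_eq_zero_of_dvd hdvd⟩] at h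
  obtain ⟨d, hd, -⟩ := pow_dvd_of_vNLoop_eq_inr h
  omega

theorem vN_of_vNLoop_eq_inr {N : ℕ} {a : ℤ} (ha : a ≠ 0) {m : ℕ} (h : vNLoop N a 0 = Sum.inr m) :
    vN N a = Sum.inr (m : ℕ∞) := by
  rw [vN, if_neg ha, h]
  rfl

theorem vN_of_vNLoop_eq_inl {N : ℕ} {a : ℤ} (ha : a ≠ 0) {d : ℕ} (h : vNLoop N a 0 = Sum.inl d) :
    vN N a = Sum.inl d := by
  rw [vN, if_neg ha, h]
  rfl

@[simp]
theorem vNValue_zero (N : ℕ) : vNValue N 0 = ⊤ := by simp [vNValue, vN]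

theorem vNValue_ne_top {N : ℕ} {a : ℤ} (ha : a ≠ 0) : vNValue N a ≠ ⊤ := by
  rcases h : vNLoop N a 0 with d | m
  · simp [vNValue, vN_of_vNLoop_eq_inl ha h]
  · simp [vNValue, vN_of_vNLoop_eq_inr ha h]

/-- This holds also where the routine fails, since the junk value is then `0`. -/
theorem pow_dvd_of_le_vNValue {N : ℕ} {a : ℤ} {k : ℕ} (hk : (k : ℕ∞) ≤ vNValue N a) :
    (N : ℤ) ^ k ∣ a := by
  by_cases ha : a = 0
  · simp [ha]
  rcases h : vNLoop N a 0 with d | m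
  · have : k = 0 := by simpa [vNValue, vN_of_vNLoop_eq_inl ha h] using hk
    simp [this]
  · have hkm : k ≤ m := by simpa [vNValue, vN_of_vNLoop_eq_inr ha h] using hk
    obtain ⟨d, hd, hdvd⟩ := pow_dvd_of_vNLoop_eq_inr h
    exact (pow_dvd_pow _ (by omega)).trans hdvd

/-- Here success of the routine is essential: it rules out the junk value `0`. -/
theorem vNValue_ne_zero {N : ℕ} (hN : 1 < N) {a : ℤ} (hdvd : (N : ℤ) ∣ a)
    (hs : ∃ k : ℕ∞, vN N a = Sum.inr k) : vNValue N a ≠ 0 := by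
  by_cases ha : a = 0
  · simp [ha]
  rcases h : vNLoop N a 0 with d | m
  · simp [vN_of_vNLoop_eq_inl ha h] at hs
  · have := lt_of_vNLoop_eq_inr hN ha hdvd h
    simpa [vNValue, vN_of_vNLoop_eq_inr ha h] using this.ne'

theorem pow_dvd_coeff_of_le_vNPoly {N : ℕ} {P : ℤ[X]} {k : ℕ} (hk : (k : ℕ∞) ≤ vNPoly N P)
    (s : ℕ) : (N : ℤ) ^ k ∣ P.coeff s := by
  by_cases hs : P.coeff s = 0
  · simp [hs]
  · exact pow_dvd_of_le_vNValue (hk.trans (Finset.inf_le (mem_support_iff.mpr hs)))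

theorem vNPoly_ne_top {N : ℕ} {P : ℤ[X]} (hP : P ≠ 0) : vNPoly N P ≠ ⊤ := by
  have hlc : P.coeff P.natDegree ≠ 0 := leadingCoeff_ne_zero.mpr hP
  exact ne_top_of_le_ne_top (vNValue_ne_top hlc) (Finset.inf_le (mem_support_iff.mpr hlc))

theorem vNPoly_ne_zero {N : ℕ} (hN : 1 < N) {P : ℤ[X]} (hdvd : ∀ s, (N : ℤ) ∣ P.coeff s)
    (hs : VNSucceeds N P) : vNPoly N P ≠ 0 := by
  rw [← pos_iff_ne_zero, vNPoly, Finset.lt_inf_iff (by simp)]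
  exact fun s _ => pos_iff_ne_zero.mpr (vNValue_ne_zero hN (hdvd s) (hs s))

theorem C_mul_intDiv {P : ℤ[X]} {M : ℤ} (h : ∀ s, M ∣ P.coeff s) : C M * intDiv P M = P := by
  ext s
  rw [coeff_C_mul, intDiv, finsetSum_coeff]
  simp only [coeff_monomial, Finset.sum_ite_eq']
  split_ifs with hs
  · exact Int.mul_ediv_cancel' (h s)
  · rw [notMem_support_iff.mp hs, mul_zero]

/-! ### The gcd routine and coprimality modulo `N` -/

theorem isCoprime_of_gcd₀_eq_one {N : ℕ} {f g : (ZMod N)[X]} (h : gcd₀ N f g = Sum.inr 1) :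
    IsCoprime f g := by
  fun_induction gcd₀ N f g with
  | case1 f =>
    rw [Sum.inr.injEq] at h
    exact h ▸ isCoprime_one_left
  | case2 f g hg hb ih =>
    have h1 := (ih h).symm
    rw [modByMonic_eq_sub_mul_div, sub_eq_add_neg, ← mul_neg] at h1
    exact (IsCoprime.of_add_mul_left_left h1).of_mul_right_right
  | case3 f g hg hb => simp at h

theorem map_zmod_eq_zero_iff {N : ℕ} {P : ℤ[X]} :
    P.map (Int.castRingHom (ZMod N)) = 0 ↔ ∀ s, (N : ℤ) ∣ P.coeff s := by
  simp [Polynomial.ext_iff, ZMod.intCast_zmod_eq_zero_iff_dvd]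

/-- A Bézout relation modulo `N` specializes to a Bézout relation modulo every ideal containing
`N`. -/
theorem aeval_notMem_of_isCoprime_map {R : Type*} [CommRing R] {I : Ideal R} (hI : I ≠ ⊤) {N : ℕ}
    (hN : (N : R) ∈ I) (t : R) {P Q : ℤ[X]}
    (h : IsCoprime (P.map (Int.castRingHom (ZMod N))) (Q.map (Int.castRingHom (ZMod N))))
    (hQ : aeval t Q ∈ I) : aeval t P ∉ I := by
  intro hP
  obtain ⟨A', B', hAB⟩ := h
  obtain ⟨A, rfl⟩ := map_surjective _ (ZMod.ringHom_surjective (Int.castRingHom (ZMod N))) A'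
  obtain ⟨B, rfl⟩ := map_surjective _ (ZMod.ringHom_surjective (Int.castRingHom (ZMod N))) B'
  have h0 : (A * P + B * Q - 1).map (Int.castRingHom (ZMod N)) = 0 := by
    simp [hAB]
  obtain ⟨D, hD⟩ := C_dvd_iff_dvd_coeff _ _ |>.mpr (map_zmod_eq_zero_iff.mp h0)
  have h1 := congrArg (aeval t) hD
  simp only [map_sub, map_add, map_mul, map_one, map_natCast] at h1
  refine (Ideal.ne_top_iff_one I).mp hI ?_
  have h2 : (1 : R) = aeval t A * aeval t P + aeval t B * aeval t Q - N * aeval t D := by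
    rw [← h1]; ring
  rw [h2]
  exact I.sub_mem (I.add_mem (I.mul_mem_left _ hP) (I.mul_mem_left _ hQ)) (I.mul_mem_right _ hN)

/-! ### The `g`-expansion -/

theorem sum_expCoeff_add (g f : ℤ[X]) (k : ℕ) :
    ∑ i ∈ Finset.range k, expCoeff g f i * g ^ i + (fun q => q /ₘ g)^[k] f * g ^ k = f := by
  induction k with
  | zero => simp
  | succ k ih =>
    have h := modByMonic_add_div ((fun q => q /ₘ g)^[k] f) g
    have he : expCoeff g f k = ((fun q => q /ₘ g)^[k] f) %ₘ g := rfl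
    rw [Finset.sum_range_succ, Function.iterate_succ_apply']
    refine Eq.trans ?_ ih
    conv_rhs => rw [← h]
    rw [he]
    ring

section Reduction

variable {R : Type*} [CommRing R] {φ : ℤ →+* R} {f g : ℤ[X]} {ℓ : ℕ} {h : R[X]}

theorem map_iterate_divByMonic (hg : g.Monic) (hf : f.map φ = g.map φ ^ ℓ * h) {i : ℕ}
    (hi : i ≤ ℓ) : ((fun q => q /ₘ g)^[i] f).map φ = g.map φ ^ (ℓ - i) * h := by
  induction i with
  | zero => simpa using hf
  | succ i ih =>
    rw [Function.iterate_succ_apply', map_divByMonic _ hg, ih (by omega),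
      show ℓ - i = (ℓ - (i + 1)) + 1 by omega, pow_succ', mul_assoc,
      mul_divByMonic_cancel_left _ (hg.map φ)]

theorem map_expCoeff_of_lt (hg : g.Monic) (hf : f.map φ = g.map φ ^ ℓ * h) {i : ℕ} (hi : i < ℓ) :
    (expCoeff g f i).map φ = 0 := by
  rw [expCoeff, map_modByMonic _ hg, map_iterate_divByMonic hg hf hi.le,
    modByMonic_eq_zero_iff_dvd (hg.map φ)]
  exact (dvd_pow_self _ (by omega)).mul_right h

theorem map_expCoeff_ne_zero [Nontrivial R] (hg : g.Monic) (hg0 : 0 < g.natDegree)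
    (hf : f.map φ = g.map φ ^ ℓ * h) (hh : IsCoprime h (g.map φ)) :
    (expCoeff g f ℓ).map φ ≠ 0 := by
  rw [expCoeff, map_modByMonic _ hg, map_iterate_divByMonic hg hf le_rfl, Nat.sub_self, pow_zero,
    one_mul, Ne, modByMonic_eq_zero_iff_dvd (hg.map φ)]
  intro hdvd
  have hone := (hg.map φ).eq_one_of_isUnit (hh.isUnit_of_dvd' hdvd dvd_rfl)
  have := hg.natDegree_map φ
  rw [hone, natDegree_one] at this
  omega

end Reduction

theorem IsSquarefreeDecomposition.exists_map_eq_pow_mul {N : ℕ} {f : ℤ[X]} {m : ℕ}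
    {G : Fin m → ℤ[X]} {l : Fin m → ℕ} (hdec : IsSquarefreeDecomposition N f G l) (j : Fin m) :
    ∃ h : (ZMod N)[X],
      f.map (Int.castRingHom (ZMod N)) = (G j).map (Int.castRingHom (ZMod N)) ^ l j * h ∧
        IsCoprime h ((G j).map (Int.castRingHom (ZMod N))) := by
  refine ⟨∏ i ∈ Finset.univ.erase j, (G i).map (Int.castRingHom (ZMod N)) ^ l i, ?_, ?_⟩
  · rw [hdec.prod_eq]
    exact (Finset.mul_prod_erase _ _ (Finset.mem_univ j)).symm
  · exact IsCoprime.prod_left fun i hi => (hdec.coprime i j (Finset.ne_of_mem_erase hi)).pow_left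

theorem expCoeff_zero_ne_zero {f g : ℤ[X]} (hf : f.Monic) (hfi : Irreducible f) (hg : g.Monic)
    (hg0 : 0 < g.natDegree) (hgf : g ≠ f) : expCoeff g f 0 ≠ 0 := by
  rw [expCoeff, Function.iterate_zero, id, Ne, modByMonic_eq_zero_iff_dvd hg]
  intro hdvd
  have hu : ¬ IsUnit g := fun hu => by
    rw [hg.eq_one_of_isUnit hu, natDegree_one] at hg0
    exact hg0.false
  exact hgf (eq_of_monic_of_associated hg hf ((hfi.dvd_iff.mp hdvd).resolve_left hu).symm)

/-- If `g` divides `f` modulo `N`, then `deg g ≤ deg f`, so that `g` cannot be a proper multiple of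
the minimal polynomial `f` of `θ`. -/
theorem aeval_ne_zero_of_dvd_map {R : Type*} [CommRing R] [Nontrivial R] {φ : ℤ →+* R} {f g : ℤ[X]}
    (hf : f.Monic) (hfi : Irreducible f) (hg : g.Monic) (hgf : g ≠ f)
    (hdvd : g.map φ ∣ f.map φ) {L : Type*} [CommRing L] [IsDomain L] [CharZero L] {θ : L}
    (hθ : aeval θ f = 0) : aeval θ g ≠ 0 := by
  intro h0
  have hint : IsIntegral ℤ θ := ⟨f, hf, hθ⟩
  have h1 : f ∣ g := ((hfi.dvd_iff.mp (minpoly.isIntegrallyClosed_dvd hint hθ)).resolve_left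
    (minpoly.not_isUnit ℤ θ)).dvd.trans (minpoly.isIntegrallyClosed_dvd hint h0)
  have h2 : g.natDegree ≤ f.natDegree := by
    obtain ⟨c, hc⟩ := hdvd
    have hc0 : c ≠ 0 := by
      rintro rfl
      exact (hf.map φ).ne_zero (by simpa using hc)
    rw [← hf.natDegree_map φ, hc, (hg.map φ).natDegree_mul' hc0, hg.natDegree_map φ]
    omega
  exact hgf (eq_of_monic_of_dvd_of_natDegree_le hf hg h1 h2)

/-! ### Supporting lines of a cloud of points -/

/-- A line of slope `-lam` supporting the cloud and passing through two of its points carries a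
side. -/
theorem exists_isSide_of_supporting {u : ℕ → ℕ∞} {lam c : ℚ} (hlam : 0 < lam)
    (hc : ∀ i, u i ≠ ⊤ → c ≤ (u i).toNat + lam * i) {a b : ℕ} (hab : a < b) (ha : u a ≠ ⊤)
    (hb : u b ≠ ⊤) (hac : (u a).toNat + lam * a = c) (hbc : (u b).toNat + lam * b = c) :
    ∃ s t, IsSide u s t lam ∧ (s ≤ a ∧ u s ≠ ⊤ ∧ (u s).toNat + lam * s = c) ∧
      b ≤ t ∧ u t ≠ ⊤ ∧ (u t).toNat + lam * t = c := by
  classical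
  have hfin : {i : ℕ | u i ≠ ⊤ ∧ (u i).toNat + lam * i = c}.Finite := by
    refine (Set.finite_Iic ⌊c / lam⌋₊).subset fun i hi => Nat.le_floor ?_
    rw [le_div_iff₀ hlam, mul_comm]
    have : (0 : ℚ) ≤ (u i).toNat := Nat.cast_nonneg _
    linarith [hi.2]
  have haS : a ∈ hfin.toFinset := by simp [ha, hac]
  have hbS : b ∈ hfin.toFinset := by simp [hb, hbc]
  obtain ⟨s, hs, hmin⟩ := hfin.toFinset.exists_min_image id ⟨a, haS⟩
  obtain ⟨t, ht, hmax⟩ := hfin.toFinset.exists_max_image id ⟨a, haS⟩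
  have hsa : s ≤ a := hmin a haS
  have hbt : b ≤ t := hmax b hbS
  simp only [Set.Finite.mem_toFinset, Set.mem_ofPred_eq, id] at hs ht hmin hmax
  refine ⟨s, t, ⟨by omega, hs.1, ht.1, by linarith [hs.2, ht.2], fun i hi => ?_, fun i hi hi' => ?_⟩,
    ⟨hsa, hs⟩, hbt, ht⟩
  · linarith [hc i hi, hs.2]
  · have hmem : u i ≠ ⊤ ∧ (u i).toNat + lam * i = c := ⟨hi, by linarith [hs.2]⟩
    exact ⟨hmin i hmem, hmax i hmem⟩

section Cloud

variable {u : ℕ → ℕ∞} {ℓ : ℕ}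

theorem toNat_pos_of_lt (hlt : ∀ i < ℓ, u i ≠ 0) {i : ℕ} (hi : i < ℓ) (hiu : u i ≠ ⊤) :
    (0 : ℚ) < (u i).toNat := by
  exact_mod_cast ENat.toNat_pos (hlt i hi) hiu

/-- The point of abscissa `ℓ` is the right endpoint of the last side of negative slope: rotate the
horizontal line through it until it meets a point further left. -/
theorem exists_isSide_right_end (h0 : u 0 ≠ ⊤) (hℓ : u ℓ = 0) (hlt : ∀ i < ℓ, u i ≠ 0)
    (hpos : 0 < ℓ) : ∃ lam : ℚ, 0 < lam ∧ ∃ t, IsSide u t ℓ lam := by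
  classical
  obtain ⟨a, ha, hmin⟩ := ((Finset.range ℓ).filter (u · ≠ ⊤)).exists_min_image
    (fun i => ((u i).toNat : ℚ) / ((ℓ : ℚ) - i)) ⟨0, by simp [h0, hpos]⟩
  simp only [Finset.mem_filter, Finset.mem_range] at ha hmin
  have hsub : ∀ {i : ℕ}, i < ℓ → (0 : ℚ) < (ℓ : ℚ) - i := fun hi => sub_pos.mpr (mod_cast hi)
  have hlam : 0 < ((u a).toNat : ℚ) / ((ℓ : ℚ) - a) :=
    div_pos (toNat_pos_of_lt hlt ha.1 ha.2) (hsub ha.1)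
  have hae : ((u a).toNat : ℚ) = ((u a).toNat : ℚ) / ((ℓ : ℚ) - a) * ((ℓ : ℚ) - a) :=
    (div_mul_cancel₀ _ (hsub ha.1).ne').symm
  generalize ((u a).toNat : ℚ) / ((ℓ : ℚ) - a) = lam at hmin hlam hae
  have hgt : ∀ i, ℓ < i → lam * ℓ < (u i).toNat + lam * i := fun i hi => by
    have h1 : lam * ℓ < lam * i := mul_lt_mul_of_pos_left (mod_cast hi) hlam
    have h2 : (0 : ℚ) ≤ (u i).toNat := Nat.cast_nonneg _
    linarith
  obtain ⟨s, t, hst, -, ht, htu, hte⟩ := exists_isSide_of_supporting (u := u) (c := lam * ℓ) hlam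
    (fun i hi => by
      rcases lt_trichotomy i ℓ with h | rfl | h
      · have := (le_div_iff₀ (hsub h)).mp (hmin i ⟨h, hi⟩)
        linarith
      · simp [hℓ]
      · exact (hgt i h).le)
    ha.1 ha.2 (by simp [hℓ]) (by linarith) (by simp [hℓ])
  obtain rfl : t = ℓ := by
    by_contra hne
    exact (hgt t (by omega)).ne' hte
  exact ⟨lam, hlam, s, hst⟩

/-- A point of abscissa `s < ℓ` which is the only one on a supporting line of slope `-μ` is the left
endpoint of a side: rotate that line around it until it meets a point further right. -/
theorem exists_isSide_left_end (hℓ : u ℓ = 0) (hlt : ∀ i < ℓ, u i ≠ 0) {μ : ℚ}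
    {s : ℕ} (hsℓ : s < ℓ) (hs : u s ≠ ⊤)
    (hmin : ∀ i, i ≠ s → u i ≠ ⊤ → (u s).toNat + μ * s < (u i).toNat + μ * i) :
    ∃ lam : ℚ, 0 < lam ∧ ∃ t, IsSide u s t lam := by
  classical
  obtain ⟨b, hb, hmax⟩ := ((Finset.Ioc s ℓ).filter (u · ≠ ⊤)).exists_max_image
    (fun i => (((u s).toNat : ℚ) - (u i).toNat) / ((i : ℚ) - s)) ⟨ℓ, by simp [hℓ, hsℓ]⟩
  simp only [Finset.mem_filter, Finset.mem_Ioc] at hb hmax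
  have hsub : ∀ {i : ℕ}, s < i → (0 : ℚ) < (i : ℚ) - s := fun hi => sub_pos.mpr (mod_cast hi)
  have hbe := div_mul_cancel₀ (((u s).toNat : ℚ) - (u b).toNat) (hsub hb.1.1).ne'
  generalize (((u s).toNat : ℚ) - (u b).toNat) / ((b : ℚ) - s) = lam at hmax hbe
  have hℓle : (u s).toNat ≤ lam * (ℓ - s) := by
    simpa [hℓ] using (div_le_iff₀ (hsub hsℓ)).mp (hmax ℓ ⟨⟨hsℓ, le_rfl⟩, by simp [hℓ]⟩)
  have hlam : 0 < lam :=
    pos_of_mul_pos_left ((toNat_pos_of_lt hlt hsℓ hs).trans_le hℓle) (hsub hsℓ).le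
  have hlamμ : lam < μ := by
    have := hmin b hb.1.1.ne' hb.2
    refine lt_of_mul_lt_mul_right (a := (b : ℚ) - s) ?_ (hsub hb.1.1).le
    linarith
  have hleft : ∀ i, i < s → u i ≠ ⊤ → (u s).toNat + lam * s < (u i).toNat + lam * i := by
    intro i hi hiu
    have h1 := hmin i hi.ne hiu
    have h2 : (0 : ℚ) < (s : ℚ) - i := sub_pos.mpr (mod_cast hi)
    have h3 := mul_lt_mul_of_pos_right hlamμ h2
    linarith
  obtain ⟨s', t, hst, ⟨hs', hsu', hse'⟩, -⟩ := exists_isSide_of_supporting (u := u)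
    (c := (u s).toNat + lam * s) hlam
    (fun i hi => by
      rcases lt_trichotomy i s with h | rfl | h
      · exact (hleft i h hi).le
      · rfl
      · rcases le_or_gt i ℓ with h' | h'
        · have := (div_le_iff₀ (hsub h)).mp (hmax i ⟨⟨h, h'⟩, hi⟩)
          linarith
        · have h1 : lam * ℓ < lam * i := mul_lt_mul_of_pos_left (mod_cast h') hlam
          have h2 : (0 : ℚ) ≤ (u i).toNat := Nat.cast_nonneg _
          linarith)
    hb.1.1 hs hb.2 rfl (by linarith)
  obtain rfl : s' = s := by
    by_contra hne
    exact (hleft s' (by omega) hsu').ne' hse'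
  exact ⟨lam, hlam, t, hst⟩

/-- The supporting line of slope `-μ < 0` of a cloud whose principal part runs from abscissa `0` to
abscissa `ℓ` either carries a side, or meets the cloud only at a vertex of its principal part. -/
theorem exists_isSide_or_vertex (h0 : u 0 ≠ ⊤) (hℓ : u ℓ = 0) (hlt : ∀ i < ℓ, u i ≠ 0)
    (hpos : 0 < ℓ) {μ : ℚ} (hμ : 0 < μ) :
    (∃ s t, IsSide u s t μ) ∨
      ∃ s ≤ ℓ, u s ≠ ⊤ ∧
        (∃ lam : ℚ, 0 < lam ∧ ∃ t, IsSide u s t lam ∨ IsSide u t s lam) ∧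
        ∀ i, i ≠ s → u i ≠ ⊤ → (u s).toNat + μ * s < (u i).toNat + μ * i := by
  classical
  obtain ⟨s, hs, hmin⟩ := ((Finset.range (ℓ + 1)).filter (u · ≠ ⊤)).exists_min_image
    (fun i => (u i).toNat + μ * i) ⟨0, by simp [h0]⟩
  simp only [Finset.mem_filter, Finset.mem_range, Nat.lt_succ_iff] at hs hmin
  have hall : ∀ i, u i ≠ ⊤ → (u s).toNat + μ * s ≤ (u i).toNat + μ * i := by
    intro i hi
    rcases le_or_gt i ℓ with h | h
    · exact hmin i ⟨h, hi⟩
    · have h1 : μ * ℓ < μ * i := mul_lt_mul_of_pos_left (mod_cast h) hμ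
      have h2 : (0 : ℚ) ≤ (u i).toNat := Nat.cast_nonneg _
      have h3 := hmin ℓ ⟨le_rfl, by simp [hℓ]⟩
      simp only [hℓ, ENat.toNat_zero, Nat.cast_zero] at h3
      linarith
  by_cases hex : ∃ i, i ≠ s ∧ u i ≠ ⊤ ∧ (u i).toNat + μ * i = (u s).toNat + μ * s
  · left
    obtain ⟨i, his, hiu, hie⟩ := hex
    rcases his.lt_or_gt with h | h
    · obtain ⟨a, b, hab, -⟩ := exists_isSide_of_supporting hμ hall h hiu hs.2 hie rfl
      exact ⟨a, b, hab⟩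
    · obtain ⟨a, b, hab, -⟩ := exists_isSide_of_supporting hμ hall h hs.2 hiu rfl hie
      exact ⟨a, b, hab⟩
  · right
    push Not at hex
    have hstrict : ∀ i, i ≠ s → u i ≠ ⊤ → (u s).toNat + μ * s < (u i).toNat + μ * i :=
      fun i his hiu => (hall i hiu).lt_of_ne (hex i his hiu).symm
    refine ⟨s, hs.1, hs.2, ?_, hstrict⟩
    rcases hs.1.lt_or_eq with h | rfl
    · obtain ⟨lam, hlam, t, ht⟩ := exists_isSide_left_end hℓ hlt h hs.2 hstrict
      exact ⟨lam, hlam, t, Or.inl ht⟩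
    · obtain ⟨lam, hlam, t, ht⟩ := exists_isSide_right_end h0 hℓ hlt hpos
      exact ⟨lam, hlam, t, Or.inr ht⟩

end Cloud

/-! ### Valuations at a prime dividing `N` -/

variable {K : Type*} [Field K] [NumberField K]

theorem mem_primesDividing {M : ℕ} {𝔭 : HeightOneSpectrum (𝓞 K)} :
    𝔭 ∈ primesDividing K M ↔ (M : 𝓞 K) ∈ 𝔭.asIdeal := by
  simp [primesDividing, Ideal.dvd_span_singleton]

theorem primesDividing_subset_of_dvd {a b : ℕ} (h : a ∣ b) :
    primesDividing K a ⊆ primesDividing K b := by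
  intro 𝔭 h𝔭
  rw [mem_primesDividing] at h𝔭 ⊢
  exact Ideal.mem_of_dvd _ (Nat.cast_dvd_cast h) h𝔭

theorem intValuation_natCast_prime {p : ℕ} (hp : p.Prime) {𝔭 : HeightOneSpectrum (𝓞 K)}
    (h𝔭 : 𝔭 ∈ primesDividing K p) :
    𝔭.intValuation (p : 𝓞 K) = WithZero.exp (-(𝔭.asIdeal.ramificationIdx ℤ : ℤ)) := by
  have hpz : Prime (p : ℤ) := Nat.prime_iff_prime_int.mp hp
  have : 𝔭.asIdeal.LiesOver (Ideal.span {(p : ℤ)}) :=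
    (Ideal.liesOver_span_iff 𝔭.isPrime.ne_top hpz).mpr (by simpa using mem_primesDividing.mp h𝔭)
  rw [𝔭.intValuation_eq_exp_neg_multiplicity (mod_cast hp.ne_zero),
    Ideal.IsDedekindDomain.ramificationIdx_eq_multiplicity (Ideal.span {(p : ℤ)})]
  · simp [Ideal.map_span]
  · simp [Ideal.map_span, hp.ne_zero]

theorem intValuation_natCast {p : ℕ} (hp : p.Prime) {N : ℕ} (hN : N ≠ 0)
    {𝔭 : HeightOneSpectrum (𝓞 K)} (h𝔭 : 𝔭 ∈ primesDividing K p) :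
    𝔭.intValuation (N : 𝓞 K) =
      WithZero.exp (-((𝔭.asIdeal.ramificationIdx ℤ * padicValNat p N : ℕ) : ℤ)) := by
  have := Fact.mk hp
  obtain ⟨M, hM⟩ := pow_padicValNat_dvd (p := p) (n := N)
  have hpM : ¬ p ∣ M := by
    rintro ⟨M', rfl⟩
    refine pow_succ_padicValNat_not_dvd (p := p) hN ⟨M', ?_⟩
    rw [pow_succ, mul_assoc, ← hM]
  have hM1 : 𝔭.intValuation (M : 𝓞 K) = 1 := by
    rw [HeightOneSpectrum.intValuation_eq_one_iff]
    intro hmem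
    obtain ⟨a, b, hab⟩ := (Nat.isCoprime_iff_coprime.mpr ((hp.coprime_iff_not_dvd).mpr hpM))
    refine (Ideal.ne_top_iff_one _).mp 𝔭.isPrime.ne_top ?_
    have h1 : (1 : 𝓞 K) = a * p + b * M := by exact_mod_cast congrArg (Int.cast : ℤ → 𝓞 K) hab.symm
    rw [h1]
    exact add_mem (Ideal.mul_mem_left _ _ (mem_primesDividing.mp h𝔭)) (Ideal.mul_mem_left _ _ hmem)
  conv_lhs => rw [hM]
  rw [Nat.cast_mul, Nat.cast_pow, map_mul, map_pow, hM1, mul_one, intValuation_natCast_prime hp h𝔭,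
    ← WithZero.exp_nsmul]
  congr 1
  rw [nsmul_eq_mul, Nat.cast_mul]
  ring

theorem ord_eq_of_intValuation_eq_exp {𝔭 : HeightOneSpectrum (𝓞 K)} {x : 𝓞 K} {n : ℤ}
    (h : 𝔭.intValuation x = WithZero.exp (-n)) : ord 𝔭 (x : K) = ((n : ℚ) : WithTop ℚ) := by
  have hx : (x : K) ≠ 0 := by
    intro h0
    have hx0 : x = 0 := by exact_mod_cast h0
    exact WithZero.exp_ne_zero (h.symm.trans (by simp [hx0]))
  rw [ord, if_neg hx, 𝔭.valuation_of_algebraMap, h, WithZero.log_exp, neg_neg]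

theorem exists_intValuation_eq_exp (𝔭 : HeightOneSpectrum (𝓞 K)) {x : 𝓞 K} (hx : x ≠ 0) :
    ∃ n : ℤ, 𝔭.intValuation x = WithZero.exp (-n) :=
  ⟨-WithZero.log (𝔭.intValuation x), by
    rw [neg_neg, WithZero.exp_log (𝔭.intValuation_ne_zero x hx)]⟩

theorem mem_asIdeal_of_ord_pos {𝔭 : HeightOneSpectrum (𝓞 K)} {x : 𝓞 K} (h : 0 < ord 𝔭 (x : K)) :
    x ∈ 𝔭.asIdeal := by
  by_cases hx : x = 0
  · simp [hx]
  obtain ⟨n, hn⟩ := exists_intValuation_eq_exp 𝔭 hx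
  rw [ord_eq_of_intValuation_eq_exp hn] at h
  have h' : 0 < n := by exact_mod_cast h
  rw [← 𝔭.intValuation_lt_one_iff_mem, hn, ← WithZero.exp_zero, WithZero.exp_lt_exp]
  omega

/-- `v_𝔭(P(t)) ≥ v_𝔭(N) k` when `N ^ k` divides `P`. -/
theorem intValuation_aeval_le {𝔭 : HeightOneSpectrum (𝓞 K)} {N E : ℕ}
    (hE : 𝔭.intValuation (N : 𝓞 K) = WithZero.exp (-(E : ℤ))) {P : ℤ[X]} {k : ℕ}
    (hk : ∀ s, (N : ℤ) ^ k ∣ P.coeff s) (t : 𝓞 K) :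
    𝔭.intValuation (aeval t P) ≤ WithZero.exp (-((E * k : ℕ) : ℤ)) := by
  rw [← C_mul_intDiv hk, map_mul, map_mul, aeval_C, map_pow, map_natCast, map_pow, hE,
    ← WithZero.exp_nsmul]
  refine (mul_le_of_le_one_right' (𝔭.intValuation_le_one _)).trans_eq ?_
  congr 1
  push_cast
  ring

/-- At an abscissa where the gcd routine outputs `1`, the valuation of the coefficient is exactly
that predicted by its ordinate. -/
theorem intValuation_aeval_expCoeff_eq {𝔭 : HeightOneSpectrum (𝓞 K)} {N E : ℕ}
    (hE : 𝔭.intValuation (N : 𝓞 K) = WithZero.exp (-(E : ℤ))) (h𝔭 : 𝔭 ∈ primesDividing K N)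
    {g f : ℤ[X]} {t : 𝓞 K} (hg : aeval t g ∈ 𝔭.asIdeal) {s : ℕ} (hs : ordinate N g f s ≠ ⊤)
    (hgcd : gcd₀ N (vertexCoeff N g f s) (g.map (Int.castRingHom (ZMod N))) = Sum.inr 1) :
    𝔭.intValuation (aeval t (expCoeff g f s)) =
      WithZero.exp (-((E * (ordinate N g f s).toNat : ℕ) : ℤ)) := by
  have hdvd := pow_dvd_coeff_of_le_vNPoly (N := N) (P := expCoeff g f s)
    (k := (ordinate N g f s).toNat) (ENat.natCast_toNat hs).le
  have h1 : 𝔭.intValuation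
      (aeval t (intDiv (expCoeff g f s) ((N : ℤ) ^ (ordinate N g f s).toNat))) = 1 := by
    rw [HeightOneSpectrum.intValuation_eq_one_iff]
    exact aeval_notMem_of_isCoprime_map 𝔭.isPrime.ne_top (mem_primesDividing.mp h𝔭) t
      (isCoprime_of_gcd₀_eq_one hgcd) hg
  conv_lhs => rw [← C_mul_intDiv hdvd]
  rw [map_mul, map_mul, h1, mul_one, aeval_C, map_pow, map_natCast, map_pow, hE,
    ← WithZero.exp_nsmul]
  congr 1
  push_cast
  ring

/-- The theorem of the polygon at a single prime: if the valuation of every vertex coefficient at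
`𝔭` is detected by its ordinate, then `v_𝔭(g(t)) / v_𝔭(N)` is the opposite of a slope. -/
theorem div_mem_principalSlopes {N E : ℕ} (hE0 : 0 < E) {𝔭 : HeightOneSpectrum (𝓞 K)}
    (hE : 𝔭.intValuation (N : 𝓞 K) = WithZero.exp (-(E : ℤ)))
    {g f : ℤ[X]} {t : 𝓞 K} (ht : aeval t f = 0) {γ : ℤ} (hγ0 : 0 < γ)
    (hγ : 𝔭.intValuation (aeval t g) = WithZero.exp (-γ)) {ℓ : ℕ} (hpos : 0 < ℓ)
    (h0 : ordinate N g f 0 ≠ ⊤) (hℓ : ordinate N g f ℓ = 0) (hlt : ∀ i < ℓ, ordinate N g f i ≠ 0)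
    (hvert : ∀ s, IsPrincipalVertex N g f s → ordinate N g f s ≠ ⊤ →
      𝔭.intValuation (aeval t (expCoeff g f s)) =
        WithZero.exp (-((E * (ordinate N g f s).toNat : ℕ) : ℤ))) :
    (γ : ℚ) / E ∈ principalSlopes N g f := by
  have hEq : (0 : ℚ) < E := mod_cast hE0
  have hμ : (0 : ℚ) < γ / E := div_pos (mod_cast hγ0) hEq
  refine ⟨hμ, (exists_isSide_or_vertex h0 hℓ hlt hpos hμ).resolve_right ?_⟩
  rintro ⟨s, hsℓ, hs, hsv, hmin⟩
  set u := ordinate N g f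
  -- Clear the denominator `E` of the slope.
  have hmin' : ∀ i, i ≠ s → u i ≠ ⊤ →
      (E * (u s).toNat : ℤ) + γ * s < E * (u i).toNat + γ * i := by
    intro i his hiu
    have h1 := mul_lt_mul_of_pos_left (hmin i his hiu) hEq
    have h2 : ∀ k : ℕ, (E : ℚ) * ((u k).toNat + γ / E * k) = E * (u k).toNat + γ * k := by
      intro k; field_simp
    rw [h2, h2] at h1
    exact_mod_cast h1
  have hγpow : ∀ i : ℕ, 𝔭.intValuation (aeval t g ^ i) = WithZero.exp (-(γ * i)) := by
    intro i
    rw [map_pow, hγ, ← WithZero.exp_nsmul]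
    congr 1
    rw [nsmul_eq_mul]
    ring
  have hterm : 𝔭.intValuation (aeval t (expCoeff g f s) * aeval t g ^ s) =
      WithZero.exp (-(E * (u s).toNat + γ * s)) := by
    rw [map_mul, hvert s hsv hs, hγpow, ← WithZero.exp_add]
    congr 1
    push_cast
    ring
  have hsum := congrArg (aeval t) (sum_expCoeff_add g f (ℓ + 1))
  simp only [map_add, map_sum, map_mul, map_pow, ht] at hsum
  rw [← Finset.add_sum_erase _ _ (Finset.mem_range.mpr (Nat.lt_succ_of_le hsℓ)), add_assoc,
    add_eq_zero_iff_eq_neg] at hsum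
  have hlt' : 𝔭.intValuation (aeval t (expCoeff g f s) * aeval t g ^ s) <
      WithZero.exp (-(E * (u s).toNat + γ * s)) := by
    rw [hsum, Valuation.map_neg]
    refine Valuation.map_add_lt _ (Valuation.map_sum_lt _ WithZero.exp_ne_zero fun i hi => ?_) ?_
    · by_cases hiu : u i = ⊤
      · have : expCoeff g f i = 0 := by
          by_contra hne
          exact vNPoly_ne_top hne hiu
        simp [this]
      · rw [map_mul, hγpow]
        have h1 := intValuation_aeval_le hE
          (pow_dvd_coeff_of_le_vNPoly (ENat.natCast_toNat hiu).le) t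
        refine (mul_le_mul_left h1 _).trans_lt ?_
        rw [← WithZero.exp_add, WithZero.exp_lt_exp]
        have h2 := hmin' i (Finset.ne_of_mem_erase hi) hiu
        push_cast
        linarith
    -- The remainder of the expansion: its quotient part is integral, and `γ (ℓ + 1) > γ ℓ`, which
    -- is at least the value at `s` because `u ℓ = 0`.
    · rw [map_mul, hγpow]
      refine (mul_le_of_le_one_left' (𝔭.intValuation_le_one _)).trans_lt ?_
      rw [WithZero.exp_lt_exp]
      have h2 : (E * (u s).toNat : ℤ) + γ * s ≤ γ * ℓ := by
        rcases eq_or_ne ℓ s with rfl | hne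
        · simp [hℓ]
        · simpa [hℓ] using (hmin' ℓ hne (by simp [hℓ])).le
      push_cast
      linarith
  exact hlt'.ne hterm

end OreModN

open OreModN Polynomial
theorem corollary3p7
    (f : ℤ[X]) (hfm : f.Monic) (hfi : Irreducible f) (hfd : 1 < f.natDegree)
    (N : ℕ) (hN : 1 < N) (hNp : ∀ q : ℕ, q.Prime → q ∣ N → f.natDegree < q)
    {K : Type*} [Field K] [NumberField K]
    (θ : K) (hθ : aeval θ f = 0) (hK : IntermediateField.adjoin ℚ {θ} = ⊤)
    {m : ℕ} (G : Fin m → ℤ[X]) (l : Fin m → ℕ)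
    (hdec : IsSquarefreeDecomposition N f G l)
    (j : Fin m) (hgf : G j ≠ f)
    -- the construction of the principal polygon does not fail
    (hpoly : ∀ i ≤ l j, VNSucceeds N (expCoeff (G j) f i))
    -- at each vertex, the gcd routine does not fail and outputs 1
    (hvert : ∀ s, IsPrincipalVertex N (G j) f s →
      gcd₀ N (vertexCoeff N (G j) f s) ((G j).map (Int.castRingHom (ZMod N))) = Sum.inr 1)
    (p : ℕ) (hp : p.Prime) (hpN : p ∣ N) :
    primesPG N p (G j) θ = {𝔭 ∈ primesDividing K p | 0 < ord 𝔭 (aeval θ (G j))} ∧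
    (principalSlopes N (G j) f).PairwiseDisjoint (primesPGSlope N p (G j) θ) ∧
    primesPG N p (G j) θ = ⋃ lam ∈ principalSlopes N (G j) f, primesPGSlope N p (G j) θ lam := by
  have := Fact.mk hp
  have := Fact.mk hN
  have hN0 : N ≠ 0 := by omega
  have hE0 : ∀ 𝔭 : IsDedekindDomain.HeightOneSpectrum (NumberField.RingOfIntegers K),
      0 < 𝔭.asIdeal.ramificationIdx ℤ * padicValNat p N := fun 𝔭 =>
    have := 𝔭.isPrime
    Nat.mul_pos (Ideal.ramificationIdx_pos _ _)
      (Nat.pos_of_ne_zero (dvd_iff_padicValNat_ne_zero hN0 |>.mp hpN))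
  refine ⟨?_, ?_, ?_⟩
  · ext 𝔭
    constructor
    · rintro ⟨⟨-, h⟩, h'⟩
      exact ⟨h', h⟩
    · rintro ⟨h', h⟩
      exact ⟨⟨primesDividing_subset_of_dvd hpN h', h⟩, h'⟩
  · intro a _ b _ hab
    refine Set.disjoint_left.mpr fun 𝔭 ha hb => hab ?_
    have h1 := WithTop.coe_injective (ha.2.symm.trans hb.2)
    exact mul_left_cancel₀ (by exact_mod_cast (hE0 𝔭).ne') h1
  · refine Set.Subset.antisymm (fun 𝔭 h => ?_) (Set.iUnion₂_subset fun _ _ 𝔭 h => h.1)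
    obtain ⟨⟨h𝔭N, hord⟩, h𝔭p⟩ := id h
    obtain ⟨q, hfac, hq⟩ := hdec.exists_map_eq_pow_mul j
    have hg := hdec.monic j
    have hg0 := hdec.natDegree_pos j
    let t : NumberField.RingOfIntegers K := ⟨θ, f, hfm, hθ⟩
    have haeval : ∀ P : ℤ[X], aeval θ P = ((aeval t P : NumberField.RingOfIntegers K) : K) :=
      fun P => aeval_algebraMap_apply K t P
    have ht : aeval t f = 0 := by
      have := haeval f
      rw [hθ] at this
      exact_mod_cast this.symm
    rw [haeval] at hord
    have hgmem := mem_asIdeal_of_ord_pos hord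
    -- For `ℓ = 0`, `g` is coprime to `f` modulo `N`, so `𝔭` would not contain `f(θ) = 0`.
    have hpos : 0 < l j := by
      refine Nat.pos_of_ne_zero fun hl => ?_
      rw [hl, pow_zero, one_mul] at hfac
      refine aeval_notMem_of_isCoprime_map 𝔭.isPrime.ne_top (mem_primesDividing.mp h𝔭N) t
        (P := f) (hfac ▸ hq) hgmem ?_
      rw [ht]
      exact zero_mem _
    have hgt : aeval t (G j) ≠ 0 := aeval_ne_zero_of_dvd_map hfm hfi hg hgf
      (hfac ▸ (dvd_pow_self _ hpos.ne').mul_right q) ht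
    obtain ⟨γ, hγ⟩ := exists_intValuation_eq_exp 𝔭 hgt
    have hordγ := ord_eq_of_intValuation_eq_exp hγ
    have hγ0 : 0 < γ := by
      rw [hordγ] at hord
      exact_mod_cast hord
    have hE := intValuation_natCast hp hN0 h𝔭p
    have hslope := div_mem_principalSlopes (hE0 𝔭) hE ht hγ0 hγ hpos
      (vNPoly_ne_top (expCoeff_zero_ne_zero hfm hfi hg hg0 hgf))
      (by
        by_contra hne
        refine map_expCoeff_ne_zero hg hg0 hfac hq (map_zmod_eq_zero_iff.mpr fun s => ?_)
        simpa using pow_dvd_coeff_of_le_vNPoly (k := 1)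
          (Nat.cast_one.trans_le (Order.one_le_iff_ne_zero.mpr hne)) s)
      (fun i hi => vNPoly_ne_zero hN (map_zmod_eq_zero_iff.mp (map_expCoeff_of_lt hg hfac hi))
        (hpoly i hi.le))
      (fun s hsv hs => intValuation_aeval_expCoeff_eq hE h𝔭N hgmem hs (hvert s hsv))
    refine Set.mem_iUnion₂.mpr ⟨_, hslope, h, ?_⟩
    rw [haeval, hordγ, WithTop.coe_inj]
    have : (𝔭.asIdeal.ramificationIdx ℤ * padicValNat p N : ℚ) ≠ 0 := mod_cast (hE0 𝔭).ne'
    push_cast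
    rw [mul_div_cancel₀ _ this]
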